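/- Let $k$ be an algebraically closed field, let $V_1,\dots,V_l,W_1,\dots,W_l,U$ be finite dimensional $k$-vector spaces, and let $T:\bigoplus_{i=1}^l (V_i\otimes_k W_i)\to U$ be a linear map. Say that $T$ has the right omnipresent maximal rank property if for every choice of subspaces $W_i'\subseteq W_i$ ($i=1,\dots,l$) the restriction of $T$ to $\bigoplus_{i=1}^l (V_i\otimes W_i')$ is injective or surjective. Let $B=\prod_{i=1}^l \operatorname{End}_k(V_i)$ act on $\bigoplus_i (V_i\otimes W_i)$ componentwise through $\varphi_i\cdot(v\otimes w)=\varphi_i(v)\otimes w$. Let $P_i$ be the projective space of lines in $V_i\otimes W_i$, let $P$ be the projective space of lines in $\bigoplus_i (V_i\otimes W_i)$, and let $\pi_1,\pi_2$ be the projections of $B\times P$ onto $B$ and $P$. Let $Y\subseteq B\times P$ be the set of pairs $(b,p)$ such that $T(bx)=0$ for all $x$ on the line $p$. For each $i$ let $X_i\subseteq P_i$ be an irreducible quasiprojective (that is, Zariski locally closed) subset, where $X_i=\emptyset$ is allowed, and let $C(X_i)\subseteq V_i\otimes W_i$ be its affine cone, that is, the union of $\{0\}$ and the lines belonging to $X_i$.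 Let $X\subseteq P$ be the set of lines contained in $C(X_1)\times\dots\times C(X_l)$. Write $\dim C(X_i)$ for the Krull dimension of $C(X_i)$ in the Zariski topology. **Theorem.** If $T$ has the right omnipresent maximal rank property and $\sum_{i=1}^l \dim C(X_i)\le \dim_k U$, then $\pi_1(\pi_2^{-1}(X)\cap Y)$ is contained in a proper Zariski closed subset of $B$ (regarded as an affine space over $k$). -/

import Mathlib

open scoped TensorProduct Topology LinearAlgebra.Projectivization

/-! ### The Zariski topology on a vector space and on its projective space -/

/-- The algebra of polynomial functions on the vector space `M`: the `k`-algebra of functions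
`M → k` generated by the linear forms. -/
def polyFun (k M : Type*) [Field k] [AddCommGroup M] [Module k M] : Subalgebra k (M → k) :=
  Algebra.adjoin k (Set.range fun f : Module.Dual k M => (f : M → k))

/-- The Zariski topology on `M`: the closed sets are the common zero loci of sets of polynomial
functions. -/
@[reducible]
def zariskiTopology (k M : Type*) [Field k] [AddCommGroup M] [Module k M] :
    TopologicalSpace M :=
  TopologicalSpace.ofClosed
    {Z | ∃ S : Set (M → k), S ⊆ polyFun k M ∧ Z = {x | ∀ f ∈ S, f x = 0}}
    ⟨{1}, by simp, by ext x; simp⟩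
    (by
      intro A hA
      have hA' : ∀ Z ∈ A, ∃ S : Set (M → k), S ⊆ polyFun k M ∧ Z = {x | ∀ f ∈ S, f x = 0} :=
        fun Z hZ => hA hZ
      choose! S hS hZ using hA'
      refine ⟨⋃ Z ∈ A, S Z, by simpa using hS, ?_⟩
      ext x
      simp only [Set.mem_sInter, Set.mem_iUnion, Set.mem_ofPred_eq]
      constructor
      · rintro h f ⟨Z, hZA, hf⟩
        have := h Z hZA
        rw [hZ Z hZA] at this
        exact this f hf
      · intro h Z hZA
        rw [hZ Z hZA]
        exact fun f hf => h f ⟨Z, hZA, hf⟩)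
    (by
      rintro _ ⟨S, hS, rfl⟩ _ ⟨S', hS', rfl⟩
      refine ⟨{h | ∃ f ∈ S, ∃ g ∈ S', h = f * g}, ?_, ?_⟩
      · rintro _ ⟨f, hf, g, hg, rfl⟩
        exact (polyFun k M).mul_mem (hS hf) (hS' hg)
      · ext x
        simp only [Set.mem_union, Set.mem_ofPred_eq]
        constructor
        · rintro (h | h) _ ⟨f, hf, g, hg, rfl⟩
          · simp [h f hf]
          · simp [h g hg]
        · intro h
          by_contra! hc
          obtain ⟨⟨f, hf, hfx⟩, g, hg, hgx⟩ := hc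
          exact mul_ne_zero hfx hgx (h _ ⟨f, hf, g, hg, rfl⟩))

/-- The homogeneous polynomial functions on `M` (of any degree `d`). -/
def homogPolyFun (k M : Type*) [Field k] [AddCommGroup M] [Module k M] : Set (M → k) :=
  {f | f ∈ polyFun k M ∧ ∃ d : ℕ, ∀ (c : k) (x : M), f (c • x) = c ^ d * f x}

/-- The Zariski topology on the projective space of lines in `M`: the closed sets are the common
zero loci of sets of homogeneous polynomial functions. -/
@[reducible]
def projZariskiTopology (k M : Type*) [Field k] [AddCommGroup M] [Module k M] :
    TopologicalSpace (ℙ k M) :=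
  TopologicalSpace.ofClosed
    {Z | ∃ S : Set (M → k), S ⊆ homogPolyFun k M ∧
      Z = {p : ℙ k M | ∀ f ∈ S, ∀ x ∈ p.submodule, f x = 0}}
    ⟨{1}, by
      rintro _ rfl
      exact ⟨(polyFun k M).one_mem, 0, by simp⟩, by
      ext p
      simp only [Set.mem_empty_iff_false, Set.mem_singleton_iff, forall_eq, Pi.one_apply,
        one_ne_zero, imp_false, Set.mem_ofPred_eq, false_iff]
      exact fun h => h 0 p.submodule.zero_mem⟩
    (by
      intro A hA
      have hA' : ∀ Z ∈ A, ∃ S : Set (M → k), S ⊆ homogPolyFun k M ∧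
          Z = {p : ℙ k M | ∀ f ∈ S, ∀ x ∈ p.submodule, f x = 0} := fun Z hZ => hA hZ
      choose! S hS hZ using hA'
      refine ⟨⋃ Z ∈ A, S Z, by simpa using hS, ?_⟩
      ext x
      simp only [Set.mem_sInter, Set.mem_iUnion, Set.mem_ofPred_eq]
      constructor
      · rintro h f ⟨Z, hZA, hf⟩
        have := h Z hZA
        rw [hZ Z hZA] at this
        exact this f hf
      · intro h Z hZA
        rw [hZ Z hZA]
        exact fun f hf => h f ⟨Z, hZA, hf⟩)
    (by
      rintro _ ⟨S, hS, rfl⟩ _ ⟨S', hS', rfl⟩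
      refine ⟨{h | ∃ f ∈ S, ∃ g ∈ S', h = f * g}, ?_, ?_⟩
      · rintro _ ⟨f, hf, g, hg, rfl⟩
        obtain ⟨hf1, d, hd⟩ := hS hf
        obtain ⟨hg1, d', hd'⟩ := hS' hg
        refine ⟨(polyFun k M).mul_mem hf1 hg1, d + d', fun c x => ?_⟩
        simp only [Pi.mul_apply, hd, hd']
        ring
      · ext p
        simp only [Set.mem_union, Set.mem_ofPred_eq]
        constructor
        · rintro (h | h) _ ⟨f, hf, g, hg, rfl⟩ x hx
          · simp [h f hf x hx]
          · simp [h g hg x hx]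
        · intro h
          by_contra! hc
          obtain ⟨⟨f, hf, x, hx, hfx⟩, g, hg, y, hy, hgy⟩ := hc
          obtain ⟨-, d, hd⟩ := hS hf
          obtain ⟨-, d', hd'⟩ := hS' hg
          rw [Projectivization.submodule_eq, Submodule.mem_span_singleton] at hx hy
          obtain ⟨a, rfl⟩ := hx
          obtain ⟨b, rfl⟩ := hy
          rw [hd] at hfx
          rw [hd'] at hgy
          refine mul_ne_zero (right_ne_zero_of_mul hfx) (right_ne_zero_of_mul hgy)
            (h _ ⟨f, hf, g, hg, rfl⟩ p.rep ?_)
          rw [Projectivization.submodule_eq]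
          exact Submodule.mem_span_singleton_self _)

/-- The dimension of a subset `S` of `M`: its Krull dimension as a subspace of `M` with the Zariski
topology. -/
noncomputable def zariskiDim (k : Type*) {M : Type*} [Field k] [AddCommGroup M] [Module k M]
    (S : Set M) : WithBot ℕ∞ :=
  letI := zariskiTopology k M
  topologicalKrullDim S

/-- `X` is an irreducible quasiprojective subset of the projective space of `M`: it is locally
closed and irreducible for the Zariski topology. The empty set is allowed (its affine cone is
`{0}`). -/
def IsIrreducibleQuasiprojective {k M : Type*} [Field k] [AddCommGroup M] [Module k M]
    (X : Set (ℙ k M)) : Prop :=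
  letI := projZariskiTopology k M
  IsLocallyClosed X ∧ IsPreirreducible X

/-- The affine cone over a subset of projective space: the origin together with the union of the
lines that are points of `X`. -/
def affineCone {k M : Type*} [Field k] [AddCommGroup M] [Module k M]
    (X : Set (ℙ k M)) : Set M :=
  {x | x = 0 ∨ ∃ p ∈ X, x ∈ p.submodule}

/-! ### Tensor products and the maximal rank property

The finite direct sum of the `V i ⊗ W i` is the module of tuples `∀ i, V i ⊗[k] W i`. -/

section

variable {k : Type*} [Field k] {l : ℕ} {V W : Fin l → Type*} {U : Type*}
  [∀ i, AddCommGroup (V i)] [∀ i, Module k (V i)]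
  [∀ i, AddCommGroup (W i)] [∀ i, Module k (W i)]
  [AddCommGroup U] [Module k U]

/-- The subspace `⨁ V i ⊗ W' i` of `⨁ V i ⊗ W i`. -/
def tensorSubspace (V : Fin l → Type*) [∀ i, AddCommGroup (V i)] [∀ i, Module k (V i)]
    (W' : ∀ i, Submodule k (W i)) : Submodule k (∀ i, V i ⊗[k] W i) :=
  Submodule.pi Set.univ fun i => LinearMap.range ((W' i).subtype.lTensor (V i))

/-- The right omnipresent maximal rank property: for all subspaces `W' i` of `W i`, the restriction
of `T` to `⨁ V i ⊗ W' i` is injective or surjective. -/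
def RightOmnipresentMaxRank (T : (∀ i, V i ⊗[k] W i) →ₗ[k] U) : Prop :=
  ∀ W' : ∀ i, Submodule k (W i),
    Function.Injective (T.domRestrict (tensorSubspace V W')) ∨
      Function.Surjective (T.domRestrict (tensorSubspace V W'))

/-- The action of the tuple of endomorphisms `b` on `⨁ V i ⊗ W i`:
on each component, `b i • (v ⊗ w) = b i v ⊗ w`. -/
def endAct (b : ∀ i, Module.End k (V i)) (x : ∀ i, V i ⊗[k] W i) : ∀ i, V i ⊗[k] W i :=
  fun i => (b i).rTensor (W i) (x i)

/-- The set `Y` of the pairs `(b, p)` in `B × P` such that `b` sends the line `p` into `Ker T`. -/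
def kernelIncidence (T : (∀ i, V i ⊗[k] W i) →ₗ[k] U) :
    Set ((∀ i, Module.End k (V i)) × ℙ k (∀ i, V i ⊗[k] W i)) :=
  {q | ∀ x ∈ q.2.submodule, endAct q.1 x ∈ LinearMap.ker T}

/-- The subset of the projective space of `⨁ V i ⊗ W i` corresponding to the product of the affine
cones over the `X i`. -/
def joinSet (X : ∀ i, Set (ℙ k (V i ⊗[k] W i))) : Set (ℙ k (∀ i, V i ⊗[k] W i)) :=
  {p | ∀ x ∈ p.submodule, ∀ i, x i ∈ affineCone (X i)}

end

/-! ### Polynomial functions and their homogeneous components -/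

section PolyFun

variable {k M N : Type*} [Field k] [AddCommGroup M] [Module k M] [AddCommGroup N] [Module k N]

/-! Let `D` be the product of the cones and `u` the dimension of `U`. The `b` to be confined are
those with `T (b x) = 0` for some nonzero `x` in `D` whose line lies in `D`. The orbit of `x` under
`B` is itself a sum of `V i ⊗ W' i` (`exists_range_lTensor_eq_orbit`), so the maximal rank property
applies to it: either `T` is injective on the orbit, or `b ↦ T (b x)` is onto `U`. In the injective
case `b x = 0` with `x ≠ 0`, hence some `b i` is singular and the product of the determinants
vanishes at `b`.

In the surjective case one counts parameters. For fixed `x` the solutions `b` form a subspace of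
codimension `u`, and `x` matters only up to scaling, so it contributes at most `u - 1` parameters;
together the solutions cannot fill `B`. In `exists_polyFun_vanishing`, Cramer's rule gives a
polynomial map onto these solutions from a set of dimension at most `dim B`; it is invariant under a
nontrivial scaling, and `exists_relation_of_scaling_invariant` turns this into a polynomial relation
between its coordinates. Finitely many such charts cover the surjective case.

The count uses transcendence degrees of coordinate rings, which are subadditive on products, while
the hypothesis concerns topological Krull dimension. The bridge is
`exists_irredDimLE_le_zariskiDim`, resting on Noether normalization and the Nullstellensatz. -/

theorem dual_mem_polyFun (f : Module.Dual k M) : (f : M → k) ∈ polyFun k M :=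
  Algebra.subset_adjoin ⟨f, rfl⟩

theorem const_mem_polyFun (c : k) : (fun _ => c : M → k) ∈ polyFun k M :=
  (polyFun k M).algebraMap_mem c

theorem polyFun_induction {p : (f : M → k) → f ∈ polyFun k M → Prop}
    (dual : ∀ f : Module.Dual k M, p f (dual_mem_polyFun f))
    (const : ∀ c : k, p (fun _ => c) (const_mem_polyFun c))
    (add : ∀ f g hf hg, p f hf → p g hg → p (f + g) ((polyFun k M).add_mem hf hg))
    (mul : ∀ f g hf hg, p f hf → p g hg → p (f * g) ((polyFun k M).mul_mem hf hg))
    {f : M → k} (hf : f ∈ polyFun k M) : p f hf := by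
  refine Algebra.adjoin_induction (p := p) ?_ const add mul hf
  rintro _ ⟨f, rfl⟩
  exact dual f

/-- A map whose composites with linear forms are polynomial pulls back polynomial functions to
polynomial functions. -/
theorem comp_mem_polyFun {φ : M → N} (hφ : ∀ f : Module.Dual k N, (fun x => f (φ x)) ∈ polyFun k M)
    {f : N → k} (hf : f ∈ polyFun k N) : (fun x => f (φ x)) ∈ polyFun k M := by
  induction hf using polyFun_induction with
  | dual f => exact hφ f
  | const c => exact const_mem_polyFun c
  | add f g _ _ hf hg => exact (polyFun k M).add_mem hf hg
  | mul f g _ _ hf hg => exact (polyFun k M).mul_mem hf hg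

theorem comp_linearMap_mem_polyFun (φ : M →ₗ[k] N) {f : N → k} (hf : f ∈ polyFun k N) :
    (fun x => f (φ x)) ∈ polyFun k M :=
  comp_mem_polyFun (fun g => dual_mem_polyFun (g ∘ₗ φ)) hf

theorem comp_affine_mem_polyFun (φ : M →ₗ[k] N) (y : N) {f : N → k} (hf : f ∈ polyFun k N) :
    (fun x => f (φ x + y)) ∈ polyFun k M := by
  refine comp_mem_polyFun (fun g => ?_) hf
  simp only [map_add]
  exact (polyFun k M).add_mem (dual_mem_polyFun (g ∘ₗ φ)) (const_mem_polyFun (g y))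

theorem sum_mem_polyFun {ι : Type*} (s : Finset ι) {f : ι → M → k}
    (hf : ∀ i ∈ s, f i ∈ polyFun k M) : (fun x => ∑ i ∈ s, f i x) ∈ polyFun k M := by
  have := (polyFun k M).sum_mem hf
  rwa [show (fun x => ∑ i ∈ s, f i x) = ∑ i ∈ s, f i by ext; simp]

theorem prod_mem_polyFun {ι : Type*} (s : Finset ι) {f : ι → M → k}
    (hf : ∀ i ∈ s, f i ∈ polyFun k M) : (fun x => ∏ i ∈ s, f i x) ∈ polyFun k M := by
  have := (polyFun k M).prod_mem hf
  rwa [show (fun x => ∏ i ∈ s, f i x) = ∏ i ∈ s, f i by ext; simp]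

theorem det_mem_polyFun {n : Type*} [Fintype n] [DecidableEq n] {A : M → Matrix n n k}
    (hA : ∀ i j, (fun x => A x i j) ∈ polyFun k M) : (fun x => (A x).det) ∈ polyFun k M := by
  simp only [Matrix.det_apply']
  exact sum_mem_polyFun _ fun σ _ => (polyFun k M).mul_mem (const_mem_polyFun _)
    (prod_mem_polyFun _ fun i _ => hA _ _)

theorem adjugate_mem_polyFun {n : Type*} [Fintype n] [DecidableEq n] {A : M → Matrix n n k}
    (hA : ∀ i j, (fun x => A x i j) ∈ polyFun k M) (i j : n) :
    (fun x => (A x).adjugate i j) ∈ polyFun k M := by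
  simp only [Matrix.adjugate_apply]
  refine det_mem_polyFun fun a b => ?_
  by_cases h : a = j
  · subst h
    simpa using const_mem_polyFun _
  · simpa [Matrix.updateRow_ne h] using hA a b

/-- A polynomial function is a finite sum of homogeneous polynomial functions. -/
theorem exists_homogeneous_decomposition {f : M → k} (hf : f ∈ polyFun k M) :
    ∃ P : M → Polynomial k, (∀ c x, (P x).eval c = f (c • x)) ∧
      (∀ j, (fun x => (P x).coeff j) ∈ polyFun k M) ∧
      ∀ j c x, (P (c • x)).coeff j = c ^ j * (P x).coeff j := by
  induction hf using polyFun_induction with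
  | dual f =>
    refine ⟨fun x => Polynomial.monomial 1 (f x), by simp [mul_comm], fun j => ?_, fun j c x => ?_⟩
    · by_cases h : 1 = j
      · simpa [Polynomial.coeff_monomial, h] using dual_mem_polyFun f
      · simpa [Polynomial.coeff_monomial, h] using const_mem_polyFun 0
    · by_cases h : 1 = j
      · simp [← h]
      · simp [Polynomial.coeff_monomial, h]
  | const a =>
    refine ⟨fun x => Polynomial.C a, by simp, fun j => const_mem_polyFun _, fun j c x => ?_⟩
    by_cases h : j = 0
    · simp [h]
    · simp [Polynomial.coeff_C, h]
  | add f g _ _ hf hg =>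
    obtain ⟨P, hP, hP', hP''⟩ := hf
    obtain ⟨Q, hQ, hQ', hQ''⟩ := hg
    refine ⟨fun x => P x + Q x, by simp [hP, hQ], fun j => ?_, fun j c x => ?_⟩
    · simp only [Polynomial.coeff_add]
      exact (polyFun k M).add_mem (hP' j) (hQ' j)
    · simp [hP'', hQ'', mul_add]
  | mul f g _ _ hf hg =>
    obtain ⟨P, hP, hP', hP''⟩ := hf
    obtain ⟨Q, hQ, hQ', hQ''⟩ := hg
    refine ⟨fun x => P x * Q x, by simp [hP, hQ], fun j => ?_, fun j c x => ?_⟩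
    · simp only [Polynomial.coeff_mul]
      exact sum_mem_polyFun _ fun i _ => (polyFun k M).mul_mem (hP' _) (hQ' _)
    · simp only [Polynomial.coeff_mul, Finset.mul_sum]
      refine Finset.sum_congr rfl fun i hi => ?_
      rw [hP'', hQ'', ← Finset.HasAntidiagonal.mem_antidiagonal.1 hi]
      ring

end PolyFun

/-! ### Coordinate rings of arbitrary subsets -/

section CoordRing

variable (k : Type*) {M : Type*} [Field k] [AddCommGroup M] [Module k M]

/-- Restriction of polynomial functions to a subset. -/
def polyRes (D : Set M) : polyFun k M →ₐ[k] (D → k) :=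
  (AlgHom.pi fun x : D => Pi.evalAlgHom k (fun _ : M => k) x.1).comp (polyFun k M).val

/-- The algebra of restrictions to `D` of polynomial functions. -/
abbrev coordRing (D : Set M) : Subalgebra k (D → k) := (polyRes k D).range

variable {k}

/-- The restriction of a polynomial function to `D`, as an element of the coordinate ring. -/
def toCoord (D : Set M) : polyFun k M →ₐ[k] coordRing k D := (polyRes k D).rangeRestrict

@[simp]
theorem toCoord_apply (D : Set M) (f : polyFun k M) (x : D) : (toCoord D f).1 x = f.1 x.1 := rfl

theorem toCoord_surjective (D : Set M) : Function.Surjective (toCoord (k := k) D) :=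
  (polyRes k D).rangeRestrict_surjective

theorem toCoord_eq_zero_iff {D : Set M} {f : polyFun k M} :
    toCoord D f = 0 ↔ ∀ x ∈ D, f.1 x = 0 := by
  constructor
  · intro h x hx
    exact congrFun (congrArg Subtype.val h) ⟨x, hx⟩
  · intro h
    ext x
    exact h x.1 x.2

/-- `D` is nonempty and irreducible for the Zariski topology. -/
def IsPolyIrred (k : Type*) {M : Type*} [Field k] [AddCommGroup M] [Module k M] (D : Set M) :
    Prop :=
  D.Nonempty ∧ ∀ f ∈ polyFun k M, ∀ g ∈ polyFun k M, (∀ x ∈ D, f x * g x = 0) →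
    (∀ x ∈ D, f x = 0) ∨ ∀ x ∈ D, g x = 0

theorem IsPolyIrred.isDomain {D : Set M} (hD : IsPolyIrred k D) : IsDomain (coordRing k D) := by
  have : Nontrivial (coordRing k D) := by
    obtain ⟨x, hx⟩ := hD.1
    refine ⟨0, 1, fun h => ?_⟩
    have := congrFun (congrArg Subtype.val h) ⟨x, hx⟩
    simp at this
  have : NoZeroDivisors (coordRing k D) := by
    refine ⟨fun {a b} hab => ?_⟩
    obtain ⟨f, rfl⟩ := toCoord_surjective D a
    obtain ⟨g, rfl⟩ := toCoord_surjective D b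
    rw [← map_mul, toCoord_eq_zero_iff] at hab
    simpa only [toCoord_eq_zero_iff] using hD.2 f.1 f.2 g.1 g.2 hab
  exact NoZeroDivisors.to_isDomain _

/-- The algebra of polynomial functions is generated by the linear forms. -/
theorem polyFun_adjoin_dual :
    Algebra.adjoin k (Set.range fun f : Module.Dual k M => (⟨f, dual_mem_polyFun f⟩ : polyFun k M))
      = ⊤ := by
  rw [eq_top_iff]
  rintro ⟨f, hf⟩ -
  induction hf using Algebra.adjoin_induction with
  | mem f hf =>
    obtain ⟨f, rfl⟩ := hf
    exact Algebra.subset_adjoin ⟨f, rfl⟩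
  | algebraMap c => exact Subalgebra.algebraMap_mem _ c
  | add f g hf hg h h' => exact Subalgebra.add_mem _ h h'
  | mul f g hf hg h h' => exact Subalgebra.mul_mem _ h h'

theorem coordRing_adjoin_dual (D : Set M) :
    Algebra.adjoin k (Set.range fun f : Module.Dual k M => toCoord D ⟨f, dual_mem_polyFun f⟩)
      = ⊤ := by
  have := congrArg (Subalgebra.map (toCoord (k := k) D)) polyFun_adjoin_dual
  rwa [AlgHom.map_adjoin, Algebra.map_top, (AlgHom.range_eq_top _).2 (toCoord_surjective D),
    ← Set.range_comp] at this

theorem polyFun_adjoin_basis {ι : Type*} [Finite ι] (b : Module.Basis ι k M) :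
    Algebra.adjoin k (Set.range fun i => (⟨b.coord i, dual_mem_polyFun _⟩ : polyFun k M)) = ⊤ := by
  cases nonempty_fintype ι
  rw [eq_top_iff, ← polyFun_adjoin_dual, Algebra.adjoin_le_iff]
  rintro _ ⟨f, rfl⟩
  have hf : (⟨f, dual_mem_polyFun f⟩ : polyFun k M) =
      ∑ i, f (b i) • (⟨b.coord i, dual_mem_polyFun _⟩ : polyFun k M) := by
    ext x
    simp only [AddSubmonoidClass.coe_finsetSum, Finset.sum_apply, SetLike.val_smul, Pi.smul_apply]
    conv_lhs => rw [← b.sum_repr x, map_sum]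
    simp [mul_comm]
  simp only [hf]
  exact Subalgebra.sum_mem _ fun i _ =>
    Subalgebra.smul_mem _ (Algebra.subset_adjoin (Set.mem_range_self i)) _

theorem coordRing_adjoin_basis {ι : Type*} [Finite ι] (b : Module.Basis ι k M) (D : Set M) :
    Algebra.adjoin k (Set.range fun i => toCoord D ⟨b.coord i, dual_mem_polyFun _⟩) = ⊤ := by
  have := congrArg (Subalgebra.map (toCoord (k := k) D)) (polyFun_adjoin_basis b)
  rwa [AlgHom.map_adjoin, Algebra.map_top, (AlgHom.range_eq_top _).2 (toCoord_surjective D),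
    ← Set.range_comp] at this

instance coordRing_finiteType [FiniteDimensional k M] (D : Set M) :
    Algebra.FiniteType k (coordRing k D) := by
  refine ⟨Subalgebra.fg_def.2 ⟨_, Set.finite_range _,
    coordRing_adjoin_basis (Module.finBasis k M) D⟩⟩

end CoordRing

/-! ### Bounds on transcendence degree -/

section Trdeg

variable {k A B C : Type*} [Field k] [CommRing A] [CommRing B] [CommRing C] [Algebra k A]
  [Algebra k B] [Algebra k C]

theorem exists_finset_isAlgebraic_of_trdeg_le [IsDomain A] {m : ℕ} (hA : Algebra.trdeg k A ≤ m) :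
    ∃ s : Finset A, s.card ≤ m ∧ ∀ a : A, IsAlgebraic (Algebra.adjoin k (s : Set A)) a := by
  obtain ⟨s, hs⟩ := exists_isTranscendenceBasis k A
  have hcard := hs.cardinalMk_eq_trdeg
  have hfin : s.Finite := by
    rw [← Cardinal.lt_aleph0_iff_set_finite, hcard]
    exact hA.trans_lt (Cardinal.natCast_lt_aleph0)
  have halg := hs.isAlgebraic
  rw [Subtype.range_coe] at halg
  refine ⟨hfin.toFinset, ?_, fun a => ?_⟩
  · rw [← hcard, ← Set.cast_ncard hfin, Set.ncard_eq_toFinset_card s hfin] at hA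
    exact_mod_cast hA
  · rw [hfin.coe_toFinset]
    exact halg.isAlgebraic a

theorem IsAlgebraic.map_adjoin [IsDomain C] (φ : A →ₐ[k] C) (hφ : Function.Injective φ)
    {s : Set A} {t : Set C} (hst : φ '' s ⊆ t) {a : A} (ha : IsAlgebraic (Algebra.adjoin k s) a) :
    IsAlgebraic (Algebra.adjoin k t) (φ a) := by
  have h : ∀ x : Algebra.adjoin k s, φ x ∈ Algebra.adjoin k t := fun x =>
    Algebra.adjoin_mono hst (by
      rw [← AlgHom.map_adjoin]
      exact ⟨x, x.2, rfl⟩)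
  let f : Algebra.adjoin k s →ₐ[k] Algebra.adjoin k t :=
    (φ.comp (Algebra.adjoin k s).val).codRestrict _ h
  refine ha.ringHom_of_comp_eq f.toRingHom φ.toRingHom (fun x y hxy => ?_) (by ext; rfl)
  exact Subtype.ext (hφ (congrArg Subtype.val hxy))

theorem trdeg_le_of_forall_isAlgebraic [IsDomain C] {n : ℕ} (s : Finset C) (hs : s.card ≤ n)
    {t : Set C} (ht : Algebra.adjoin k t = ⊤)
    (halg : ∀ x ∈ t, IsAlgebraic (Algebra.adjoin k (s : Set C)) x) : Algebra.trdeg k C ≤ n := by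
  have : Algebra.IsAlgebraic (Algebra.adjoin k (s : Set C)) C := by
    refine ⟨fun x => ?_⟩
    have hx : x ∈ Algebra.adjoin k t := ht ▸ trivial
    have : Algebra.adjoin k t ≤
        (Subalgebra.algebraicClosure (Algebra.adjoin k (s : Set C)) C).restrictScalars k :=
      Algebra.adjoin_le halg
    exact this hx
  refine (Algebra.IsAlgebraic.trdeg_le_cardinalMk k (s : Set C)).trans ?_
  simpa using hs

/-- The images of transcendence bases of `A` and `B` together make every generator of `C` algebraic.
-/
theorem trdeg_le_add_of_adjoin_eq_top [IsDomain A] [IsDomain B] [IsDomain C]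
    (φ : A →ₐ[k] C) (ψ : B →ₐ[k] C) (hφ : Function.Injective φ) (hψ : Function.Injective ψ)
    (h : Algebra.adjoin k (Set.range φ ∪ Set.range ψ) = ⊤) {m n : ℕ}
    (hA : Algebra.trdeg k A ≤ m) (hB : Algebra.trdeg k B ≤ n) :
    Algebra.trdeg k C ≤ (m + n : ℕ) := by
  classical
  obtain ⟨s, hs, hs'⟩ := exists_finset_isAlgebraic_of_trdeg_le hA
  obtain ⟨t, ht, ht'⟩ := exists_finset_isAlgebraic_of_trdeg_le hB
  refine trdeg_le_of_forall_isAlgebraic (s.image φ ∪ t.image ψ) ?_ h ?_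
  · exact (Finset.card_union_le _ _).trans
      (add_le_add (Finset.card_image_le.trans hs) (Finset.card_image_le.trans ht))
  · rintro _ (⟨a, rfl⟩ | ⟨b, rfl⟩)
    · exact (hs' a).map_adjoin φ hφ (by simp)
    · exact (ht' b).map_adjoin ψ hψ (by simp)

end Trdeg

/-! ### Irreducibility and dimension of products and of affine space -/

section Product

variable {k M N P : Type*} [Field k] [AddCommGroup M] [Module k M] [AddCommGroup N] [Module k N]
  [AddCommGroup P] [Module k P]

/-- Pullback of functions along a linear map taking `D` into `D'`. -/
def coordPullback (p : M →ₗ[k] N) {D : Set M} {D' : Set N} (h : Set.MapsTo p D D') :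
    coordRing k D' →ₐ[k] coordRing k D :=
  ((AlgHom.pi fun x : D => Pi.evalAlgHom k (fun _ : D' => k) ⟨p x, h x.2⟩).comp
    (coordRing k D').val).codRestrict _ (by
      rintro ⟨_, ⟨f, hf⟩, rfl⟩
      exact ⟨⟨_, comp_linearMap_mem_polyFun p hf⟩, rfl⟩)

@[simp]
theorem coordPullback_apply (p : M →ₗ[k] N) {D : Set M} {D' : Set N} (h : Set.MapsTo p D D')
    (f : coordRing k D') (x : D) : (coordPullback p h f).1 x = f.1 ⟨p x, h x.2⟩ := rfl

theorem coordPullback_injective (p : M →ₗ[k] N) {D : Set M} {D' : Set N} (h : Set.MapsTo p D D')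
    (h' : Set.SurjOn p D D') : Function.Injective (coordPullback p h) := by
  intro f g hfg
  ext ⟨y, hy⟩
  obtain ⟨x, hx, rfl⟩ := h' hy
  exact congrFun (congrArg Subtype.val hfg) ⟨x, hx⟩

/-- `D` is nonempty and irreducible, and its coordinate ring has transcendence degree at most
`n`. -/
structure IrredDimLE (k : Type*) {M : Type*} [Field k] [AddCommGroup M] [Module k M] (D : Set M)
    (n : ℕ) : Prop where
  irred : IsPolyIrred k D
  trdeg_le : Algebra.trdeg k (coordRing k D) ≤ n

/-- Suppose `f` is nonzero at `x` and `g` at `y`. On each slice over `a ∈ D` one of `f`, `g`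
vanishes, by irreducibility of `D'`. So the product of `f (a, x₂)` and `g (a, y₂)` is zero for all
`a ∈ D`, contradicting irreducibility of `D`. -/
theorem IsPolyIrred.prod (e : P ≃ₗ[k] M × N) {D : Set M} {D' : Set N} (hD : IsPolyIrred k D)
    (hD' : IsPolyIrred k D') : IsPolyIrred k (e ⁻¹' (D ×ˢ D')) := by
  constructor
  · obtain ⟨x, hx⟩ := hD.1
    obtain ⟨y, hy⟩ := hD'.1
    exact ⟨e.symm (x, y), by simpa using ⟨hx, hy⟩⟩
  · intro f hf g hg hfg
    by_contra! hc
    obtain ⟨⟨x, hx, hfx⟩, y, hy, hgy⟩ := hc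
    have hl : ∀ (b : N) {f : P → k}, f ∈ polyFun k P →
        (fun a => f (e.symm (a, b))) ∈ polyFun k M := by
      intro b f hf
      have := comp_affine_mem_polyFun (e.symm.toLinearMap ∘ₗ LinearMap.inl k M N)
        (e.symm (0, b)) hf
      simpa [← map_add] using this
    have hr : ∀ (a : M) {f : P → k}, f ∈ polyFun k P →
        (fun b => f (e.symm (a, b))) ∈ polyFun k N := by
      intro a f hf
      have := comp_affine_mem_polyFun (e.symm.toLinearMap ∘ₗ LinearMap.inr k M N)
        (e.symm (a, 0)) hf
      simpa [← map_add] using this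
    have key := hD.2 _ (hl (e x).2 hf) _ (hl (e y).2 hg) fun a ha => by
      rcases hD'.2 _ (hr a hf) _ (hr a hg) fun b hb => hfg _ (by simpa using ⟨ha, hb⟩) with h | h
      · rw [h _ hx.2, zero_mul]
      · rw [h _ hy.2, mul_zero]
    rcases key with h | h
    · exact hfx (by simpa using h _ hx.1)
    · exact hgy (by simpa using h _ hy.1)

/-- A linear form on a product is a sum of linear forms on the factors, so the two pulled-back
coordinate rings generate that of the product. -/
theorem IrredDimLE.prod (e : P ≃ₗ[k] M × N) {D : Set M} {D' : Set N} {m n : ℕ}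
    (hD : IrredDimLE k D m) (hD' : IrredDimLE k D' n) :
    IrredDimLE k (e ⁻¹' (D ×ˢ D')) (m + n) := by
  have hirr := hD.irred.prod e hD'.irred
  refine ⟨hirr, ?_⟩
  have := hirr.isDomain
  have := hD.irred.isDomain
  have := hD'.irred.isDomain
  have h1 : Set.MapsTo (LinearMap.fst k M N ∘ₗ e.toLinearMap) (e ⁻¹' (D ×ˢ D')) D :=
    fun x hx => hx.1
  have h2 : Set.MapsTo (LinearMap.snd k M N ∘ₗ e.toLinearMap) (e ⁻¹' (D ×ˢ D')) D' :=
    fun x hx => hx.2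
  refine trdeg_le_add_of_adjoin_eq_top (coordPullback _ h1) (coordPullback _ h2)
    (coordPullback_injective _ _ fun x hx => ?_) (coordPullback_injective _ _ fun y hy => ?_) ?_
    hD.trdeg_le hD'.trdeg_le
  · obtain ⟨y, hy⟩ := hD'.irred.1
    exact ⟨e.symm (x, y), by simpa using ⟨hx, hy⟩, by simp⟩
  · obtain ⟨x, hx⟩ := hD.irred.1
    exact ⟨e.symm (x, y), by simpa using ⟨hx, hy⟩, by simp⟩
  · rw [eq_top_iff, ← coordRing_adjoin_dual, Algebra.adjoin_le_iff]
    rintro _ ⟨f, rfl⟩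
    have hf : toCoord (e ⁻¹' (D ×ˢ D')) ⟨f, dual_mem_polyFun f⟩ =
        coordPullback _ h1 (toCoord D ⟨f ∘ₗ e.symm.toLinearMap ∘ₗ LinearMap.inl k M N,
          dual_mem_polyFun _⟩) +
        coordPullback _ h2 (toCoord D' ⟨f ∘ₗ e.symm.toLinearMap ∘ₗ LinearMap.inr k M N,
          dual_mem_polyFun _⟩) := by
      ext x
      simp [← map_add]
    simp only [hf]
    exact Subalgebra.add_mem _ (Algebra.subset_adjoin (Or.inl (Set.mem_range_self _)))
      (Algebra.subset_adjoin (Or.inr (Set.mem_range_self _)))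

theorem IrredDimLE.of_subsingleton [Subsingleton M] : IrredDimLE k (Set.univ : Set M) 0 := by
  have hirr : IsPolyIrred k (Set.univ : Set M) := by
    refine ⟨⟨0, trivial⟩, fun f _ g _ h => ?_⟩
    rcases mul_eq_zero.1 (h 0 trivial) with h | h
    · exact Or.inl fun x _ => Subsingleton.elim x 0 ▸ h
    · exact Or.inr fun x _ => Subsingleton.elim x 0 ▸ h
  refine ⟨hirr, ?_⟩
  have := hirr.isDomain
  refine trdeg_le_of_forall_isAlgebraic ∅ le_rfl (coordRing_adjoin_dual Set.univ) ?_
  rintro _ ⟨f, rfl⟩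
  have : toCoord (Set.univ : Set M) ⟨f, dual_mem_polyFun f⟩ = 0 :=
    toCoord_eq_zero_iff.2 fun x _ => by simp [Subsingleton.elim x 0]
  simp only [this]
  exact isAlgebraic_zero

theorem IrredDimLE.pi {l : ℕ} {M : Fin l → Type*} [∀ i, AddCommGroup (M i)]
    [∀ i, Module k (M i)] {D : ∀ i, Set (M i)} {n : Fin l → ℕ}
    (h : ∀ i, IrredDimLE k (D i) (n i)) : IrredDimLE k (Set.univ.pi D) (∑ i, n i) := by
  induction l with
  | zero =>
    have : Set.univ.pi D = Set.univ := by ext; simp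
    rw [this]
    simpa using IrredDimLE.of_subsingleton
  | succ l ih =>
    have := (h 0).prod (Fin.consLinearEquiv k M).symm (ih fun i => h i.succ)
    rw [Fin.sum_univ_succ]
    convert this using 1
    ext x
    simp [Fin.forall_fin_succ, Fin.consLinearEquiv, Fin.tail]

/-- Over an infinite field a polynomial is determined by its values, so this reduces to the absence
of zero divisors in `MvPolynomial`. -/
theorem IsPolyIrred.univ [Infinite k] [FiniteDimensional k M] :
    IsPolyIrred k (Set.univ : Set M) := by
  let b := Module.finBasis k M
  have key : ∀ f ∈ polyFun k M, ∃ F : MvPolynomial (Fin (Module.finrank k M)) k,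
      ∀ x, f x = MvPolynomial.eval (b.equivFun x) F := by
    intro f hf
    induction hf using polyFun_induction with
    | dual f =>
      refine ⟨∑ i, MvPolynomial.C (f (b i)) * MvPolynomial.X i, fun x => ?_⟩
      conv_lhs => rw [← b.sum_equivFun x, map_sum]
      simp [mul_comm]
    | const c => exact ⟨MvPolynomial.C c, by simp⟩
    | add f g _ _ hf hg =>
      obtain ⟨F, hF⟩ := hf
      obtain ⟨G, hG⟩ := hg
      exact ⟨F + G, by simp [hF, hG]⟩
    | mul f g _ _ hf hg =>
      obtain ⟨F, hF⟩ := hf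
      obtain ⟨G, hG⟩ := hg
      exact ⟨F * G, by simp [hF, hG]⟩
  refine ⟨⟨0, trivial⟩, fun f hf g hg h => ?_⟩
  obtain ⟨F, hF⟩ := key f hf
  obtain ⟨G, hG⟩ := key g hg
  have : F * G = 0 := MvPolynomial.funext fun y => by
    have := h (b.equivFun.symm y) trivial
    rw [hF, hG, LinearEquiv.apply_symm_apply] at this
    rw [map_mul, this, map_zero]
  rcases mul_eq_zero.1 this with h | h
  · exact Or.inl fun x _ => by simp [hF, h]
  · exact Or.inr fun x _ => by simp [hG, h]

theorem IrredDimLE.univ [Infinite k] [FiniteDimensional k M] :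
    IrredDimLE k (Set.univ : Set M) (Module.finrank k M) := by
  classical
  refine ⟨IsPolyIrred.univ, ?_⟩
  have := (IsPolyIrred.univ (k := k) (M := M)).isDomain
  let b := Module.finBasis k M
  refine trdeg_le_of_forall_isAlgebraic
    (Finset.univ.image fun i => toCoord Set.univ ⟨b.coord i, dual_mem_polyFun _⟩)
    (Finset.card_image_le.trans (by simp)) (coordRing_adjoin_basis b Set.univ) fun x hx => ?_
  have hx' : x ∈ Algebra.adjoin k (((Finset.univ.image fun i =>
      toCoord Set.univ ⟨b.coord i, dual_mem_polyFun _⟩ : Finset (coordRing k (Set.univ : Set M))) :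
        Set (coordRing k (Set.univ : Set M)))) :=
    Algebra.subset_adjoin (by simpa using hx)
  exact isAlgebraic_algebraMap (⟨x, hx'⟩ : Algebra.adjoin k _)

end Product

/-! ### Krull dimension and the Nullstellensatz -/

section Ring

/-- Lying over and going up lift every chain of primes of `R` to a chain in `S` of the same length.
-/
theorem ringKrullDim_le_of_isIntegral (R S : Type*) [CommRing R] [CommRing S] [Algebra R S]
    [Algebra.IsIntegral R S] [FaithfulSMul R S] : ringKrullDim R ≤ ringKrullDim S := by
  refine iSup_le fun l => ?_
  obtain ⟨P, hP, hPl⟩ := Ideal.nonempty_primesOver (S := S) (RelSeries.head l).asIdeal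
  obtain ⟨L, hL, -⟩ := Ideal.exists_ltSeries_of_hasGoingUp l P
  rw [← hL]
  exact le_iSup (fun L : LTSeries (PrimeSpectrum S) => (L.length : WithBot ℕ∞)) L

/-- The transcendence degree of a finitely generated domain is at most its Krull dimension. -/
theorem exists_trdeg_le_ringKrullDim (k L : Type*) [Field k] [CommRing L] [IsDomain L]
    [Algebra k L] [Algebra.FiniteType k L] :
    ∃ n : ℕ, Algebra.trdeg k L ≤ n ∧ (n : WithBot ℕ∞) ≤ ringKrullDim L := by
  classical
  -- Noether normalization: `L` is integral over a polynomial ring in `n` variables, and this `n`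
  -- serves for both inequalities.
  obtain ⟨n, g, hg, hg'⟩ := exists_integral_inj_algHom_of_fg k L
  refine ⟨n, ?_, ?_⟩
  · refine trdeg_le_of_forall_isAlgebraic (Finset.univ.image fun i => g (MvPolynomial.X i))
      (Finset.card_image_le.trans (by simp)) (t := Set.univ) (by simp) fun x _ => ?_
    have hmem : ∀ p, g p ∈ Algebra.adjoin k
        ((Finset.univ.image fun i => g (MvPolynomial.X i) : Finset L) : Set L) := by
      intro p
      have : g p ∈ Subalgebra.map g (Algebra.adjoin k (Set.range MvPolynomial.X)) :=
        ⟨p, by simp [MvPolynomial.adjoin_range_X], rfl⟩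
      rw [AlgHom.map_adjoin, ← Set.range_comp] at this
      simpa [Function.comp_def] using this
    let g' := g.codRestrict _ hmem
    obtain ⟨p, hp, hpx⟩ := hg' x
    have : IsIntegral (Algebra.adjoin k
        ((Finset.univ.image fun i => g (MvPolynomial.X i) : Finset L) : Set L)) x := by
      refine ⟨p.map g'.toRingHom, hp.map _, ?_⟩
      rw [Polynomial.eval₂_map]
      exact hpx
    exact this.isAlgebraic
  · algebraize [g.toRingHom]
    have : Algebra.IsIntegral (MvPolynomial (Fin n) k) L := ⟨hg'⟩
    have : FaithfulSMul (MvPolynomial (Fin n) k) L :=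
      (faithfulSMul_iff_algebraMap_injective _ _).2 hg
    have h := ringKrullDim_le_of_isIntegral (MvPolynomial (Fin n) k) L
    rw [MvPolynomial.ringKrullDim_of_isNoetherianRing] at h
    simpa using h

/-- A form of the Nullstellensatz: a function not in a prime ideal is nonzero at some point of the
corresponding variety. -/
theorem exists_algHom_of_notMem_prime {k L : Type*} [Field k] [IsAlgClosed k] [CommRing L]
    [Algebra k L] [Algebra.FiniteType k L] (p : Ideal L) [p.IsPrime] {a : L} (ha : a ∉ p) :
    ∃ χ : L →ₐ[k] k, (∀ x ∈ p, χ x = 0) ∧ χ a ≠ 0 := by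
  have : IsJacobsonRing L := isJacobsonRing_of_finiteType (A := k)
  -- In a Jacobson ring `p` is an intersection of maximal ideals, so some maximal ideal above `p`
  -- misses `a`; its residue field is `k`.
  have hp := (isJacobsonRing_iff_prime_eq.1 this) p inferInstance
  rw [← hp, Ideal.jacobson, Ideal.mem_sInf] at ha
  push Not at ha
  obtain ⟨m, ⟨hpm, hm⟩, ham⟩ := ha
  let := Ideal.Quotient.field m
  have := finite_of_finite_type_of_isJacobsonRing k (L ⧸ m)
  let e := AlgEquiv.ofBijective (Algebra.ofId k (L ⧸ m))
    (IsAlgClosed.algebraMap_bijective_of_isIntegral (k := k) (K := L ⧸ m))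
  refine ⟨e.symm.toAlgHom.comp (Ideal.Quotient.mkₐ k m), fun x hx => ?_, ?_⟩
  · simp [Ideal.Quotient.eq_zero_iff_mem.2 (hpm hx)]
  · simpa [Ideal.Quotient.eq_zero_iff_mem] using ham

end Ring

/-! ### Transcendence degree against topological Krull dimension -/

section Dimension

variable {k M : Type*} [Field k] [AddCommGroup M] [Module k M]

theorem isClosed_ofClosed_iff {α : Type*} {T : Set (Set α)} {h₀ : ∅ ∈ T}
    {h₁ : ∀ A ⊆ T, ⋂₀ A ∈ T} {h₂ : ∀ A ∈ T, ∀ B ∈ T, A ∪ B ∈ T} {Z : Set α} :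
    IsClosed[TopologicalSpace.ofClosed T h₀ h₁ h₂] Z ↔ Z ∈ T := by
  rw [← @isOpen_compl_iff _ _ (TopologicalSpace.ofClosed T h₀ h₁ h₂)]
  change Zᶜᶜ ∈ T ↔ _
  rw [compl_compl]

theorem isClosed_zariski_iff {Z : Set M} : IsClosed[zariskiTopology k M] Z ↔
    ∃ S : Set (M → k), S ⊆ polyFun k M ∧ Z = {x | ∀ f ∈ S, f x = 0} :=
  isClosed_ofClosed_iff

/-- Every character of the coordinate ring of `D` is the evaluation at a point of the Zariski
closure of `D`. -/
theorem exists_point_of_algHom [FiniteDimensional k M] {D : Set M} (χ : coordRing k D →ₐ[k] k) :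
    ∃ y : M, ∀ f : polyFun k M, χ (toCoord D f) = f.1 y := by
  -- On linear forms the character is an element of the bidual, hence evaluation at a point.
  let ψ : Module.Dual k (Module.Dual k M) :=
    { toFun := fun f => χ (toCoord D ⟨f, dual_mem_polyFun f⟩)
      map_add' := fun f g => by
        rw [← map_add, ← map_add]
        rfl
      map_smul' := fun c f => by
        rw [RingHom.id_apply, ← map_smul, ← map_smul]
        rfl }
  obtain ⟨y, hy⟩ := (Module.evalEquiv k M).surjective ψ
  refine ⟨y, ?_⟩
  rintro ⟨f, hf⟩
  induction hf using polyFun_induction with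
  | dual f =>
    have := LinearMap.congr_fun hy f
    exact this.symm
  | const c =>
    exact (χ.comp (toCoord D)).commutes c
  | add f g hf hg h h' =>
    have : (⟨f + g, (polyFun k M).add_mem hf hg⟩ : polyFun k M) = ⟨f, hf⟩ + ⟨g, hg⟩ := rfl
    rw [this, map_add, map_add, h, h']
    rfl
  | mul f g hf hg h h' =>
    have : (⟨f * g, (polyFun k M).mul_mem hf hg⟩ : polyFun k M) = ⟨f, hf⟩ * ⟨g, hg⟩ := rfl
    rw [this, map_mul, map_mul, h, h']
    rfl

/-- The dimension of an irreducible set that is open in its closure is at least the transcendence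
degree of its coordinate ring. -/
theorem exists_irredDimLE_le_zariskiDim [IsAlgClosed k] [FiniteDimensional k M] {C : Set M}
    (hC : IsPolyIrred k C) {f : M → k} (hf : f ∈ polyFun k M) (hf0 : ∃ x ∈ C, f x ≠ 0)
    (hopen : ∀ y, (∀ g ∈ polyFun k M, (∀ x ∈ C, g x = 0) → g y = 0) → f y ≠ 0 → y ∈ C) :
    ∃ n : ℕ, IrredDimLE k C n ∧ (n : WithBot ℕ∞) ≤ zariskiDim k C := by
  have hdom := hC.isDomain
  set a : coordRing k C := toCoord C ⟨f, hf⟩ with ha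
  have ha0 : a ≠ 0 := by
    rw [ha, Ne, toCoord_eq_zero_iff]
    push Not
    exact hf0
  have hle : Submonoid.powers a ≤ nonZeroDivisors (coordRing k C) :=
    powers_le_nonZeroDivisors_of_noZeroDivisors ha0
  -- Inverting `a` discards the zeros of `f`; by `hopen` all remaining points of the closure lie in
  -- `C`, so primes of the localization have enough zeros in `C` itself.
  have hdomL : IsDomain (Localization.Away a) := IsLocalization.isDomain_localization hle
  have hinj : Function.Injective (algebraMap (coordRing k C) (Localization.Away a)) :=
    IsLocalization.injective _ hle
  have hft : Algebra.FiniteType k (Localization.Away a) :=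
    Algebra.FiniteType.trans (S := coordRing k C) inferInstance inferInstance
  obtain ⟨n, hn, hn'⟩ := exists_trdeg_le_ringKrullDim k (Localization.Away a)
  refine ⟨n, ⟨hC, (trdeg_le_of_injective
    (IsScalarTower.toAlgHom k (coordRing k C) (Localization.Away a)) hinj).trans hn⟩,
    hn'.trans ?_⟩
  let Z : Ideal (Localization.Away a) → Set C := fun p =>
    {x | ∀ g : polyFun k M, algebraMap _ (Localization.Away a) (toCoord C g) ∈ p → g.1 x.1 = 0}
  -- Nullstellensatz within `C`: a polynomial function vanishing on `Z p` belongs to `p`. It makes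
  -- `Z p` irreducible and `Z` strictly order-reversing.
  have hZ : ∀ p : Ideal (Localization.Away a), p.IsPrime → ∀ g : polyFun k M,
      (∀ x ∈ Z p, g.1 x.1 = 0) → algebraMap _ (Localization.Away a) (toCoord C g) ∈ p := by
    intro p hp g hg
    by_contra hgp
    obtain ⟨χ, hχ, hχg⟩ := exists_algHom_of_notMem_prime (k := k) p hgp
    obtain ⟨y, hy⟩ := exists_point_of_algHom
      (χ.comp (IsScalarTower.toAlgHom k (coordRing k C) (Localization.Away a)))
    simp only [AlgHom.comp_apply, IsScalarTower.coe_toAlgHom'] at hy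
    have hyC : y ∈ C := by
      refine hopen y (fun g hg h => ?_) ?_
      · change (⟨g, hg⟩ : polyFun k M).1 y = 0
        rw [← hy, toCoord_eq_zero_iff.2 h, map_zero, map_zero]
      · change (⟨f, hf⟩ : polyFun k M).1 y ≠ 0
        rw [← hy]
        exact ((IsLocalization.Away.algebraMap_isUnit a).map χ).ne_zero
    refine hχg ?_
    rw [hy g]
    exact hg ⟨y, hyC⟩ fun h hh => by rw [← hy h, hχ _ hh]
  let := zariskiTopology k M
  have hclosed : ∀ p, IsClosed (Z p) := by
    intro p
    rw [isClosed_induced_iff]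
    refine ⟨{x | ∀ g ∈ {g : M → k | ∃ h : g ∈ polyFun k M,
      algebraMap _ (Localization.Away a) (toCoord C ⟨g, h⟩) ∈ p}, g x = 0},
      isClosed_zariski_iff.2 ⟨_, fun g hg => hg.1, rfl⟩, ?_⟩
    ext x
    simp [Z]
  have hirr : ∀ p : Ideal (Localization.Away a), p.IsPrime → IsIrreducible (Z p) := by
    intro p hp
    constructor
    · by_contra hne
      rw [Set.not_nonempty_iff_eq_empty] at hne
      have := hZ p hp 1 (by simp [hne])
      rw [map_one, map_one] at this
      exact hp.ne_top ((Ideal.eq_top_iff_one _).2 this)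
    · rw [isPreirreducible_iff_isClosed_union_isClosed]
      intro z₁ z₂ h₁ h₂ h
      rw [isClosed_induced_iff] at h₁ h₂
      obtain ⟨_, hz₁, rfl⟩ := h₁
      obtain ⟨_, hz₂, rfl⟩ := h₂
      obtain ⟨S₁, hS₁, rfl⟩ := isClosed_zariski_iff.1 hz₁
      obtain ⟨S₂, hS₂, rfl⟩ := isClosed_zariski_iff.1 hz₂
      by_contra! hc
      simp only [Set.not_subset] at hc
      obtain ⟨⟨x, hx, hx'⟩, y, hy, hy'⟩ := hc
      simp only [Set.mem_preimage, Set.mem_ofPred_eq, not_forall] at hx' hy'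
      obtain ⟨g₁, hg₁, hx'⟩ := hx'
      obtain ⟨g₂, hg₂, hy'⟩ := hy'
      have := hZ p hp (⟨g₁, hS₁ hg₁⟩ * ⟨g₂, hS₂ hg₂⟩) fun z hz => by
        rcases h hz with h | h
        · simp [h g₁ hg₁]
        · simp [h g₂ hg₂]
      rw [map_mul, map_mul] at this
      rcases hp.mem_or_mem this with h | h
      · exact hx' (hx _ h)
      · exact hy' (hy _ h)
  have key : ringKrullDim (Localization.Away a) ≤ topologicalKrullDim C := by
    unfold ringKrullDim topologicalKrullDim
    rw [← Order.krullDim_orderDual]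
    refine Order.krullDim_le_of_strictMono
      (fun p => (⟨Z (OrderDual.ofDual p).asIdeal, hirr _ (OrderDual.ofDual p).2, hclosed _⟩ :
        TopologicalSpace.IrreducibleCloseds C)) ?_
    intro p q hpq
    have hqp : (OrderDual.ofDual q).asIdeal < (OrderDual.ofDual p).asIdeal := hpq
    refine lt_of_le_of_ne (fun x hx g hg => hx g (hqp.le hg)) fun heq => ?_
    obtain ⟨b, hbp, hbq⟩ := SetLike.exists_of_lt hqp
    -- Clearing the denominator of `b` gives a polynomial function that still separates `p` from
    -- `q`.
    obtain ⟨⟨c, s⟩, hc⟩ := IsLocalization.surj (Submonoid.powers a) b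
    obtain ⟨g, rfl⟩ := toCoord_surjective C c
    have hZeq : Z (OrderDual.ofDual p).asIdeal = Z (OrderDual.ofDual q).asIdeal :=
      congrArg TopologicalSpace.IrreducibleCloseds.carrier heq
    have hgp : algebraMap _ (Localization.Away a) (toCoord C g) ∈ (OrderDual.ofDual p).asIdeal :=
      hc ▸ Ideal.mul_mem_right _ _ hbp
    have hgq := hZ _ (OrderDual.ofDual q).2 g fun x hx => (hZeq ▸ hx :) g hgp
    rw [← hc] at hgq
    rcases (OrderDual.ofDual q).2.mem_or_mem hgq with h | h
    · exact hbq h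
    · exact (OrderDual.ofDual q).2.ne_top
        (Ideal.eq_top_of_isUnit_mem _ h (IsLocalization.map_units _ s))
  exact key

end Dimension

/-! ### Affine cones over quasiprojective sets -/

section Cone

variable {k M : Type*} [Field k] [AddCommGroup M] [Module k M]

theorem isClosed_projZariski_iff {Z : Set (ℙ k M)} : IsClosed[projZariskiTopology k M] Z ↔
    ∃ S : Set (M → k), S ⊆ homogPolyFun k M ∧
      Z = {p : ℙ k M | ∀ f ∈ S, ∀ x ∈ p.submodule, f x = 0} :=
  isClosed_ofClosed_iff

theorem zero_mem_affineCone (X : Set (ℙ k M)) : (0 : M) ∈ affineCone X := Or.inl rfl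

theorem smul_mem_affineCone {X : Set (ℙ k M)} (c : k) {x : M} (hx : x ∈ affineCone X) :
    c • x ∈ affineCone X := by
  rcases hx with rfl | ⟨p, hp, hx⟩
  · exact Or.inl (smul_zero c)
  · exact Or.inr ⟨p, hp, p.submodule.smul_mem c hx⟩

theorem forall_mem_submodule_iff {p : ℙ k M} {P : M → Prop} :
    (∀ x ∈ p.submodule, P x) ↔ ∀ c : k, P (c • p.rep) := by
  rw [Projectivization.submodule_eq]
  simp [Submodule.mem_span_singleton]

/-- Over an infinite field, `f` vanishes on a line exactly when all its homogeneous components do.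
-/
theorem isClosed_forall_mem_submodule [Infinite k] {f : M → k} (hf : f ∈ polyFun k M) :
    IsClosed[projZariskiTopology k M] {p : ℙ k M | ∀ x ∈ p.submodule, f x = 0} := by
  obtain ⟨P, hP, hP', hP''⟩ := exists_homogeneous_decomposition hf
  refine isClosed_projZariski_iff.2 ⟨Set.range fun j x => (P x).coeff j, ?_, ?_⟩
  · rintro _ ⟨j, rfl⟩
    exact ⟨hP' j, j, hP'' j⟩
  · ext p
    simp only [Set.mem_ofPred_eq, Set.forall_mem_range]
    constructor
    · intro h j x hx
      have : P x = 0 := Polynomial.funext fun c => by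
        rw [hP, h _ (p.submodule.smul_mem c hx), Polynomial.eval_zero]
      rw [this, Polynomial.coeff_zero]
    · intro h x hx
      have : P x = 0 := Polynomial.ext fun j => by rw [h j x hx, Polynomial.coeff_zero]
      rw [← one_smul k x, ← hP, this, Polynomial.eval_zero]

/-- If `f * g` vanishes on the cone, then on each line of `X` the one-variable polynomials `c ↦ f (c
• x)` and `c ↦ g (c • x)` have product zero, so one of them is zero. Thus two closed sets cover `X`,
and one of them contains it. -/
theorem isPolyIrred_affineCone [Infinite k] {X : Set (ℙ k M)}
    (hX : @IsPreirreducible _ (projZariskiTopology k M) X) : IsPolyIrred k (affineCone X) := by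
  let := projZariskiTopology k M
  refine ⟨⟨0, zero_mem_affineCone X⟩, fun f hf g hg hfg => ?_⟩
  rcases X.eq_empty_or_nonempty with rfl | ⟨p₀, hp₀⟩
  · simp only [affineCone, Set.mem_empty_iff_false, false_and, exists_false, or_false,
      Set.mem_ofPred_eq, forall_eq] at hfg ⊢
    exact mul_eq_zero.1 hfg
  · have hcone : ∀ h : M → k, (X ⊆ {p : ℙ k M | ∀ x ∈ p.submodule, h x = 0}) →
        ∀ x ∈ affineCone X, h x = 0 := by
      rintro h hh x (rfl | ⟨p, hp, hx⟩)
      · exact hh hp₀ 0 (Submodule.zero_mem _)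
      · exact hh hp x hx
    refine (isPreirreducible_iff_isClosed_union_isClosed.1 hX _ _
      (isClosed_forall_mem_submodule hf) (isClosed_forall_mem_submodule hg) ?_).imp
      (hcone f) (hcone g)
    intro p hp
    obtain ⟨P, hP, -⟩ := exists_homogeneous_decomposition hf
    obtain ⟨Q, hQ, -⟩ := exists_homogeneous_decomposition hg
    have : P p.rep * Q p.rep = 0 := Polynomial.funext fun c => by
      rw [Polynomial.eval_mul, hP, hQ, Polynomial.eval_zero]
      refine hfg _ (Or.inr ⟨p, hp, p.submodule.smul_mem c ?_⟩)
      rw [Projectivization.submodule_eq]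
      exact Submodule.mem_span_singleton_self _
    rcases mul_eq_zero.1 this with h | h
    · refine Or.inl (forall_mem_submodule_iff.2 fun c => ?_)
      rw [← hP, h, Polynomial.eval_zero]
    · refine Or.inr (forall_mem_submodule_iff.2 fun c => ?_)
      rw [← hQ, h, Polynomial.eval_zero]

/-- The affine cone of a locally closed set contains a principal open subset of its closure. -/
theorem exists_basicOpen_subset_affineCone {X : Set (ℙ k M)}
    (hX : @IsLocallyClosed _ (projZariskiTopology k M) X) :
    ∃ f ∈ polyFun k M, (∃ x ∈ affineCone X, f x ≠ 0) ∧
      ∀ y, (∀ g ∈ polyFun k M, (∀ x ∈ affineCone X, g x = 0) → g y = 0) → f y ≠ 0 →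
        y ∈ affineCone X := by
  let := projZariskiTopology k M
  rcases X.eq_empty_or_nonempty with rfl | ⟨p₀, hp₀⟩
  · refine ⟨1, (polyFun k M).one_mem, ⟨0, zero_mem_affineCone _, by simp⟩, fun y hy _ => ?_⟩
    refine Or.inl ((Module.forall_dual_apply_eq_zero_iff k y).1 fun f => ?_)
    refine hy f (dual_mem_polyFun f) ?_
    rintro x (rfl | ⟨p, hp, -⟩)
    · exact map_zero f
    · exact hp.elim
  · obtain ⟨O, Z, hO, hZ, rfl⟩ := hX
    obtain ⟨S, hS, hSO⟩ := isClosed_projZariski_iff.1 hO.isClosed_compl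
    obtain ⟨S', hS', rfl⟩ := isClosed_projZariski_iff.1 hZ
    have hp₀' : p₀ ∉ Oᶜ := fun h => h hp₀.1
    rw [hSO] at hp₀'
    simp only [Set.mem_ofPred_eq, not_forall] at hp₀'
    -- Take for `f` an equation of the complement of `O` that is not identically zero on the line
    -- `p₀`.
    obtain ⟨f, hf, x₀, hx₀, hfx⟩ := hp₀'
    refine ⟨f, (hS hf).1, ⟨x₀, Or.inr ⟨p₀, hp₀, hx₀⟩, hfx⟩, fun y hy hfy => ?_⟩
    by_cases hy0 : y = 0
    · exact Or.inl hy0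
    have hyp : y ∈ (Projectivization.mk k y hy0).submodule := by
      rw [Projectivization.submodule_mk]
      exact Submodule.mem_span_singleton_self y
    refine Or.inr ⟨Projectivization.mk k y hy0, ⟨?_, ?_⟩, hyp⟩
    · by_contra h
      have h' : Projectivization.mk k y hy0 ∈ Oᶜ := h
      rw [hSO] at h'
      exact hfy (h' f hf y hyp)
    · intro g hg x hx
      rw [Projectivization.submodule_mk, Submodule.mem_span_singleton] at hx
      obtain ⟨c, rfl⟩ := hx
      obtain ⟨hg', d, hd⟩ := hS' hg
      rw [hd, hy g hg', mul_zero]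
      rintro x (rfl | ⟨p, hp, hx⟩)
      · exact hp₀.2 g hg 0 (Submodule.zero_mem _)
      · exact hp.2 g hg x hx

theorem IsIrreducibleQuasiprojective.exists_irredDimLE [IsAlgClosed k] [FiniteDimensional k M]
    {X : Set (ℙ k M)} (hX : IsIrreducibleQuasiprojective X) :
    ∃ n : ℕ, IrredDimLE k (affineCone X) n ∧ (n : WithBot ℕ∞) ≤ zariskiDim k (affineCone X) := by
  have : Infinite k := IsAlgClosed.instInfinite
  obtain ⟨f, hf, hf0, hopen⟩ := exists_basicOpen_subset_affineCone hX.1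
  exact exists_irredDimLE_le_zariskiDim (isPolyIrred_affineCone hX.2) hf hf0 hopen

end Cone

/-! ### The dimension lost to a scaling symmetry -/

section Scaling

variable {k M : Type*} [Field k] [AddCommGroup M] [Module k M]

/-- Functions invariant under a scaling that is not trivial on `D` satisfy one more algebraic
relation than the dimension of `D` gives. -/
theorem exists_relation_of_scaling_invariant [Infinite k] {D : Set M} {n : ℕ}
    (hD : IrredDimLE k D n) (φ : Fin n → polyFun k M) (a : polyFun k M)
    (ha : ∃ x ∈ D, a.1 x ≠ 0) (σ : k → M → M) (hσ : ∀ c ≠ 0, Set.MapsTo (σ c) D D)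
    (hφ : ∀ c ≠ 0, ∀ x ∈ D, ∀ j, (φ j).1 (σ c x) = (φ j).1 x)
    (hσa : ∀ c ≠ 0, ∀ x ∈ D, a.1 (σ c x) = c * a.1 x) :
    ∃ P : MvPolynomial (Fin n) k, P ≠ 0 ∧
      ∀ x ∈ D, MvPolynomial.eval (fun j => (φ j).1 x) P = 0 := by
  have := hD.irred.isDomain
  let ev : D → coordRing k D →ₐ[k] k := fun x =>
    (Pi.evalAlgHom k (fun _ : D => k) x).comp (coordRing k D).val
  by_cases hind : AlgebraicIndependent k fun j => toCoord D (φ j)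
  · exfalso
    -- Otherwise `a` and the `φ j` would be `n + 1` independent elements in transcendence degree at
    -- most `n`. So `a` is algebraic over the algebra of the `φ j`, whose elements are scaling
    -- invariant.
    have hnot : ¬ AlgebraicIndependent k
        (fun o : Option (Fin n) => o.elim (toCoord D a) fun j => toCoord D (φ j)) := by
      intro h
      have h1 := h.lift_cardinalMk_le_trdeg
      have h2 := h1.trans (Cardinal.lift_le.2 hD.trdeg_le)
      simp only [Cardinal.mk_fintype, Fintype.card_option, Fintype.card_fin,
        Cardinal.lift_natCast, Nat.cast_le] at h2
      omega
    rw [hind.option_iff_transcendental, Transcendental, not_not] at hnot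
    obtain ⟨p, hp, hpa⟩ := hnot
    have hinv : ∀ b ∈ Algebra.adjoin k (Set.range fun j => toCoord D (φ j)), ∀ c (hc : c ≠ 0),
        ∀ x : D, b.1 ⟨σ c x.1, hσ c hc x.2⟩ = b.1 x := by
      intro b hb c hc x
      induction hb using Algebra.adjoin_induction with
      | mem b hb =>
        obtain ⟨j, rfl⟩ := hb
        exact hφ c hc x.1 x.2 j
      | algebraMap r => rfl
      | add b b' _ _ h h' => exact congrArg₂ (· + ·) h h'
      | mul b b' _ _ h h' => exact congrArg₂ (· * ·) h h'
    have ha0 : toCoord D a ≠ 0 := by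
      rw [Ne, toCoord_eq_zero_iff]
      push Not
      exact ha
    refine hp (Polynomial.ext fun j => ?_)
    have hcoeff : (p.coeff j).1 * toCoord D a ^ j = 0 := by
      ext x
      let θ : D → Algebra.adjoin k (Set.range fun j => toCoord D (φ j)) →+* k := fun x =>
        (ev x).toRingHom.comp (algebraMap _ (coordRing k D))
      let q : Polynomial k := (p.map (θ x)).comp (Polynomial.C (a.1 x) * Polynomial.X)
      -- Transporting the algebraic relation along `σ c` shows that `q` vanishes at every `c ≠ 0`;
      -- the factor `X` takes care of `c = 0`.
      have hq : q * Polynomial.X = 0 := Polynomial.funext fun c => by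
        rcases eq_or_ne c 0 with rfl | hc
        · simp
        · have h := congrArg (ev ⟨σ c x.1, hσ c hc x.2⟩).toRingHom hpa
          rw [Polynomial.aeval_def, Polynomial.hom_eval₂, map_zero] at h
          have hθ : θ ⟨σ c x.1, hσ c hc x.2⟩ = θ x :=
            RingHom.ext fun b => hinv b.1 b.2 c hc x
          have hax : (ev ⟨σ c x.1, hσ c hc x.2⟩).toRingHom (toCoord D a) = a.1 x * c :=
            (hσa c hc x.1 x.2).trans (mul_comm _ _)
          rw [hax] at h
          change Polynomial.eval₂ (θ ⟨σ c x.1, hσ c hc x.2⟩) _ p = 0 at h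
          rw [hθ] at h
          simp [q, Polynomial.eval_comp, Polynomial.eval_map, h]
      have hqj := congrArg (Polynomial.coeff · j) ((mul_eq_zero.1 hq).resolve_right
        Polynomial.X_ne_zero)
      simp only [q, Polynomial.comp_C_mul_X_coeff, Polynomial.coeff_map,
        Polynomial.coeff_zero] at hqj
      exact hqj
    have := (mul_eq_zero.1 hcoeff).resolve_right (pow_ne_zero _ ha0)
    rw [Polynomial.coeff_zero]
    exact Subtype.ext this
  · rw [algebraicIndependent_iff] at hind
    push Not at hind
    obtain ⟨P, hP, hP0⟩ := hind
    refine ⟨P, hP0, fun x hx => ?_⟩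
    have h := congrArg (ev ⟨x, hx⟩) hP
    rw [MvPolynomial.comp_aeval_apply _ (ev ⟨x, hx⟩), map_zero, MvPolynomial.aeval_eq_eval] at h
    exact h

end Scaling

/-! ### A hypersurface containing the kernels in one chart -/

section Kernel

variable {k B M : Type*} [Field k] [AddCommGroup B] [Module k B] [AddCommGroup M] [Module k M]

theorem IrredDimLE.mono {D : Set M} {m n : ℕ} (h : IrredDimLE k D m) (hmn : m ≤ n) :
    IrredDimLE k D n :=
  ⟨h.irred, h.trdeg_le.trans (by exact_mod_cast hmn)⟩

/-- The elements of `B` killed by `L · x` for some `x` in a cone `D` of dimension at most `u`, such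
that the composite of `L · x` with a fixed map from the `u`-dimensional space to `B` is bijective,
lie on a hypersurface. -/
theorem exists_polyFun_vanishing [Infinite k] [FiniteDimensional k B] {u : ℕ}
    (L : B →ₗ[k] M →ₗ[k] (Fin u → k)) {D : Set M} (hD : IrredDimLE k D u)
    (hsmul : ∀ c : k, ∀ x ∈ D, c • x ∈ D) (s : (Fin u → k) →ₗ[k] B)
    (hs : Function.Injective s) :
    ∃ F ∈ polyFun k B, (∃ b, F b ≠ 0) ∧ ∀ b, ∀ x ∈ D, x ≠ 0 → L b x = 0 →
      (LinearMap.toMatrix' (L.flip x ∘ₗ s)).det ≠ 0 → F b = 0 := by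
  -- A nonzero point of `D` is needed for a linear form `ℓ` of weight one under scaling that is not
  -- zero on `D`.
  by_cases hD0 : ∃ x ∈ D, x ≠ 0
  swap
  · push Not at hD0
    exact ⟨1, (polyFun k B).one_mem, ⟨0, one_ne_zero⟩, fun b x hx hx0 => (hx0 (hD0 x hx)).elim⟩
  obtain ⟨x₀, hx₀, hx₀'⟩ := hD0
  obtain ⟨ℓ, hℓ⟩ : ∃ ℓ : Module.Dual k M, ℓ x₀ ≠ 0 := by
    by_contra! h
    exact hx₀' ((Module.forall_dual_apply_eq_zero_iff k x₀).1 h)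
  obtain ⟨Q, hQ⟩ := (LinearMap.range s).exists_isCompl
  have hdimQ : u + Module.finrank k Q = Module.finrank k B := by
    rw [← Submodule.finrank_add_eq_of_isCompl hQ, LinearMap.finrank_range_of_inj hs]
    simp
  let e := Module.finBasis k B
  let E : M → Matrix (Fin u) (Fin u) k := fun x => LinearMap.toMatrix' (L.flip x ∘ₗ s)
  have hE : ∀ x v, Matrix.mulVec (E x) v = L (s v) x := fun x v => by
    rw [← Matrix.toLin'_apply, Matrix.toLin'_toMatrix']
    rfl
  have hEsmul : ∀ (c : k) x, E (c • x) = c • E x := fun c x => by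
    simp only [E, map_smul, LinearMap.smul_comp]
  -- Solving `L (s v + q) x = 0` by Cramer's rule gives `v = -(E x)⁻¹ (L q x)`. Multiplying `s v +
  -- q` by `det (E x)` makes it polynomial in `(x, q)`.
  let Φ : M × Q → B := fun y =>
    (E y.1).det • (y.2 : B) - s (Matrix.mulVec (E y.1).adjugate (L y.2 y.1))
  have hEpoly : ∀ i j, (fun y : M × Q => E y.1 i j) ∈ polyFun k (M × Q) := fun i j =>
    dual_mem_polyFun (LinearMap.proj i ∘ₗ L (s (Pi.single j 1)) ∘ₗ LinearMap.fst k M Q)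
  have hLpoly : ∀ i, (fun y : M × Q => L y.2 y.1 i) ∈ polyFun k (M × Q) := by
    intro i
    have : (fun y : M × Q => L y.2 y.1 i) =
        fun y : M × Q => ∑ j, e.coord j (y.2 : B) * L (e j) y.1 i := by
      ext y
      conv_lhs => rw [← e.sum_repr (y.2 : B)]
      simp only [map_sum, map_smul, LinearMap.sum_apply, LinearMap.smul_apply, Finset.sum_apply,
        Pi.smul_apply, smul_eq_mul, e.coord_apply]
    rw [this]
    exact sum_mem_polyFun _ fun j _ => (polyFun k (M × Q)).mul_mem
      (dual_mem_polyFun (e.coord j ∘ₗ Q.subtype ∘ₗ LinearMap.snd k M Q))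
      (dual_mem_polyFun (LinearMap.proj i ∘ₗ L (e j) ∘ₗ LinearMap.fst k M Q))
  have hΦpoly : ∀ j, (fun y => e.coord j (Φ y)) ∈ polyFun k (M × Q) := by
    intro j
    have : (fun y => e.coord j (Φ y)) = (fun y : M × Q => (E y.1).det * e.coord j (y.2 : B)) -
        fun y : M × Q => ∑ i, (∑ i', (E y.1).adjugate i i' * L y.2 y.1 i') *
          e.coord j (s (Pi.single i 1)) := by
      ext y
      simp only [Φ, map_sub, map_smul, Pi.sub_apply, smul_eq_mul]
      congr 1
      conv_lhs => rw [pi_eq_sum_univ' (Matrix.mulVec (E y.1).adjugate (L y.2 y.1))]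
      simp [map_sum, Matrix.mulVec, dotProduct]
    rw [this]
    refine (polyFun k (M × Q)).sub_mem ((polyFun k (M × Q)).mul_mem (det_mem_polyFun hEpoly)
      (dual_mem_polyFun (e.coord j ∘ₗ Q.subtype ∘ₗ LinearMap.snd k M Q))) ?_
    refine sum_mem_polyFun _ fun i _ => (polyFun k (M × Q)).mul_mem ?_ (const_mem_polyFun _)
    exact sum_mem_polyFun _ fun i' _ => (polyFun k (M × Q)).mul_mem
      (adjugate_mem_polyFun hEpoly i i') (hLpoly i')
  -- Under `x ↦ c • x` the determinant has weight `u`, and the adjugate (weight `u - 1`) times `L q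
  -- x` (weight `1`) also has weight `u`; scaling `q` by `c ^ (-u)` cancels both.
  have hΦinv : ∀ c : k, c ≠ 0 → ∀ y : M × Q, Φ (c • y.1, (c ^ u)⁻¹ • y.2) = Φ y := by
    intro c hc y
    simp only [Φ]
    congr 1
    · rw [hEsmul, Matrix.det_smul, Fintype.card_fin, Submodule.coe_smul, smul_smul,
        mul_right_comm, mul_inv_cancel₀ (pow_ne_zero _ hc), one_mul]
    · congr 1
      -- The exponent in `Matrix.adjugate_smul` is a truncated `u - 1`, so `u = 0` is separate.
      rcases u with _ | u
      · exact Subsingleton.elim _ _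
      · rw [hEsmul, Matrix.adjugate_smul, Fintype.card_fin, Submodule.coe_smul, map_smul L,
          LinearMap.smul_apply, map_smul (L _), Matrix.mulVec_smul, Matrix.mulVec_smul,
          Matrix.smul_mulVec, smul_smul, smul_smul, Nat.add_sub_cancel, mul_assoc, ← pow_succ',
          inv_mul_cancel₀ (pow_ne_zero _ hc), one_smul]
  have hprod : IrredDimLE k (LinearEquiv.refl k (M × Q) ⁻¹' (D ×ˢ (Set.univ : Set Q)))
      (Module.finrank k B) := (hD.prod (LinearEquiv.refl k (M × Q)) IrredDimLE.univ).mono hdimQ.le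
  obtain ⟨P, hP, hP'⟩ := exists_relation_of_scaling_invariant hprod
    (fun j => ⟨_, hΦpoly j⟩) ⟨_, dual_mem_polyFun (ℓ ∘ₗ LinearMap.fst k M Q)⟩
    ⟨(x₀, 0), ⟨hx₀, trivial⟩, hℓ⟩ (fun c y => (c • y.1, (c ^ u)⁻¹ • y.2))
    (fun c _ y hy => ⟨hsmul c _ hy.1, trivial⟩)
    (fun c hc y _ j => congrArg (e.coord j) (hΦinv c hc y))
    (fun c _ y _ => by simp)
  refine ⟨fun b => MvPolynomial.eval (fun j => e.coord j b) P, ?_, ?_, ?_⟩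
  · have : (fun b => MvPolynomial.eval (fun j => e.coord j b) P) =
        (MvPolynomial.aeval (fun j => (⟨_, dual_mem_polyFun (e.coord j)⟩ : polyFun k B)) P).1 := by
      ext b
      let ev : polyFun k B →ₐ[k] k := (Pi.evalAlgHom k (fun _ : B => k) b).comp (polyFun k B).val
      have h := MvPolynomial.comp_aeval_apply
        (fun j => (⟨_, dual_mem_polyFun (e.coord j)⟩ : polyFun k B)) ev P
      rw [MvPolynomial.aeval_eq_eval] at h
      exact h.symm
    rw [this]
    exact Subtype.property _
  · by_contra! h
    refine hP (MvPolynomial.funext fun v => ?_)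
    have := h (e.equivFun.symm v)
    rw [map_zero, ← this]
    congr 2
    ext j
    exact (congrFun (e.equivFun.apply_symm_apply v) j).symm
  · intro b x hx _ hbx hdet
    obtain ⟨w, ⟨v, rfl⟩, q, hq, rfl⟩ := Submodule.mem_sup.1
      (hQ.sup_eq_top ▸ Submodule.mem_top : b ∈ LinearMap.range s ⊔ Q)
    lift q to Q using hq
    -- Dividing `q` by the determinant undoes the cleared denominator, so `b` lies in the image of
    -- `Φ`.
    have hΦ : Φ (x, (E x).det⁻¹ • q) = s v + q := by
      have hq' : L q x = - Matrix.mulVec (E x) v := by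
        rw [hE, eq_neg_iff_add_eq_zero, add_comm, ← hbx, map_add, LinearMap.add_apply]
      have h1 : (E x).det ≠ 0 := hdet
      simp only [Φ, Submodule.coe_smul, map_smul, LinearMap.smul_apply, hq', Matrix.mulVec_smul,
        Matrix.mulVec_neg, Matrix.mulVec_mulVec, Matrix.adjugate_mul, Matrix.smul_mulVec,
        Matrix.one_mulVec, smul_neg, map_neg, smul_smul, mul_inv_cancel₀ h1, inv_mul_cancel₀ h1,
        one_smul, sub_neg_eq_add]
      exact add_comm _ _
    rw [← hΦ]
    exact hP' (x, (E x).det⁻¹ • q) ⟨hx, trivial⟩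

end Kernel

/-! ### Covering the surjective case by finitely many charts -/

section Cover

variable {k B M : Type*} [Field k] [AddCommGroup B] [Module k B] [AddCommGroup M] [Module k M]

/-- The images of the basis vectors span the target, so `u` of them form a basis of it. -/
theorem exists_det_ne_zero_of_surjective {ι : Type*} {u : ℕ} (e : Module.Basis ι k B)
    (f : B →ₗ[k] (Fin u → k)) (hf : Function.Surjective f) :
    ∃ J : Fin u → ι,
      (LinearMap.toMatrix' (f ∘ₗ Fintype.linearCombination k (fun a => e (J a)))).det ≠ 0 := by
  obtain ⟨κ, a, -, hspan, hind⟩ := exists_linearIndependent' k fun i => f (e i)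
  have htop : Submodule.span k (Set.range ((fun i => f (e i)) ∘ a)) = ⊤ := by
    rw [hspan, show (fun i => f (e i)) = f ∘ e from rfl, Set.range_comp, ← Submodule.map_span,
      e.span_eq, Submodule.map_top, LinearMap.range_eq_top.2 hf]
  let c := Module.Basis.mk hind htop.ge
  let σ := (Pi.basisFun k (Fin u)).indexEquiv c
  refine ⟨fun i => a (σ i), ?_⟩
  have hmap : f ∘ₗ Fintype.linearCombination k (fun i => e (a (σ i))) =
      ((Pi.basisFun k (Fin u)).equiv c σ).toLinearMap := by
    refine (Pi.basisFun k (Fin u)).ext fun i => ?_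
    rw [LinearEquiv.coe_coe, Module.Basis.equiv_apply]
    simp [c, Fintype.linearCombination_apply, Pi.single_apply]
  rw [hmap, LinearMap.det_toMatrix']
  exact (LinearEquiv.isUnit_det' _).ne_zero

theorem exists_prod_polyFun_ne_zero [Infinite k] [FiniteDimensional k B] {ι : Type*}
    (s : Finset ι) (F : ι → B → k) (hF : ∀ i, F i ∈ polyFun k B) (hF0 : ∀ i, ∃ b, F i b ≠ 0) :
    ∃ b, ∏ i ∈ s, F i b ≠ 0 := by
  classical
  induction s using Finset.induction_on with
  | empty => exact ⟨0, by simp⟩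
  | insert i s hi ih =>
    by_contra! h
    simp only [Finset.prod_insert hi] at h
    rcases (IsPolyIrred.univ (k := k) (M := B)).2 _ (hF i) _
      (prod_mem_polyFun s fun j _ => hF j) fun b _ => h b with h | h
    · obtain ⟨b, hb⟩ := hF0 i
      exact hb (h b trivial)
    · obtain ⟨b, hb⟩ := ih
      exact hb (h b trivial)

/-- There are finitely many choices `J` of `u` vectors from a basis of `B`, and each surjective
`L.flip x` is invertible on one of them; `F` is the product of the equations of all charts. -/
theorem exists_polyFun_vanishing_of_surjective [Infinite k] [FiniteDimensional k B] {u : ℕ}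
    (L : B →ₗ[k] M →ₗ[k] (Fin u → k)) {D : Set M} (hD : IrredDimLE k D u)
    (hsmul : ∀ c : k, ∀ x ∈ D, c • x ∈ D) :
    ∃ F ∈ polyFun k B, (∃ b, F b ≠ 0) ∧ ∀ b, ∀ x ∈ D, x ≠ 0 → L b x = 0 →
      Function.Surjective (L.flip x) → F b = 0 := by
  let e := Module.finBasis k B
  let s : (Fin u → Fin (Module.finrank k B)) → (Fin u → k) →ₗ[k] B := fun J =>
    Fintype.linearCombination k (fun a => e (J a))
  have key : ∀ J, ∃ F ∈ polyFun k B, (∃ b, F b ≠ 0) ∧ ∀ b, ∀ x ∈ D, x ≠ 0 → L b x = 0 →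
      (LinearMap.toMatrix' (L.flip x ∘ₗ s J)).det ≠ 0 → F b = 0 := by
    intro J
    by_cases hs : Function.Injective (s J)
    · exact exists_polyFun_vanishing L hD hsmul (s J) hs
    -- If `s J` is not injective its determinant is always zero, so the chart is empty.
    · refine ⟨1, (polyFun k B).one_mem, ⟨0, one_ne_zero⟩, fun b x _ _ _ hdet => (hs ?_).elim⟩
      rw [LinearMap.det_toMatrix'] at hdet
      have := (LinearMap.equivOfDetNeZero _ hdet).injective
      exact Function.Injective.of_comp (f := L.flip x) this
  choose F hF hF0 hFv using key
  refine ⟨fun b => ∏ J, F J b, prod_mem_polyFun _ fun J _ => hF J,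
    exists_prod_polyFun_ne_zero _ F hF hF0, fun b x hx hx0 hb hsurj => ?_⟩
  obtain ⟨J, hJ⟩ := exists_det_ne_zero_of_surjective e (L.flip x) hsurj
  exact Finset.prod_eq_zero (Finset.mem_univ J) (hFv J b x hx hx0 hb hJ)

end Cover

/-! ### Orbits of tensors and the maximal rank property -/

section Main

variable {k : Type*} [Field k]

/-- The orbit of a tensor `x` under `End V` is `V ⊗ W'`, with `W'` the span of the coefficients
of `x`. -/
theorem exists_range_lTensor_eq_orbit {V W : Type*} [AddCommGroup V] [Module k V]
    [FiniteDimensional k V] [AddCommGroup W] [Module k W] (x : V ⊗[k] W) :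
    ∃ W' : Submodule k W, ∀ y, y ∈ LinearMap.range (W'.subtype.lTensor V) ↔
      ∃ φ : Module.End k V, φ.rTensor W x = y := by
  classical
  let v := Module.finBasis k V
  obtain ⟨c, rfl⟩ := TensorProduct.eq_repr_basis_left v x
  let W' := Submodule.span k (Set.range c)
  have hc : ∀ j, c j ∈ W' := fun j => Submodule.subset_span ⟨j, rfl⟩
  have happ : ∀ φ : Module.End k V, φ.rTensor W (c.sum fun j w => v j ⊗ₜ[k] w) =
      ∑ j, φ (v j) ⊗ₜ[k] c j := fun φ => by
    rw [Finsupp.sum_fintype _ _ (by simp), map_sum]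
    simp
  simp only [happ]
  refine ⟨W', fun y => ⟨?_, ?_⟩⟩
  · rintro ⟨z, rfl⟩
    induction z using TensorProduct.induction_on with
    | zero => exact ⟨0, by simp⟩
    | add z z' hz hz' =>
      obtain ⟨φ, hφ⟩ := hz
      obtain ⟨φ', hφ'⟩ := hz'
      exact ⟨φ + φ', by
        simp [map_add, ← hφ, ← hφ', TensorProduct.add_tmul, Finset.sum_add_distrib]⟩
    | tmul a w =>
      obtain ⟨w, hw⟩ := w
      obtain ⟨d, rfl⟩ := (Submodule.mem_span_range_iff_exists_fun k).1 hw
      -- With `w = ∑ d j • c j`, sending `v j` to `d j • a` carries the tensor to `a ⊗ w`.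
      refine ⟨v.constr k fun j => d j • a, ?_⟩
      simp [TensorProduct.tmul_sum, TensorProduct.smul_tmul]
  · rintro ⟨φ, rfl⟩
    exact ⟨∑ j, φ (v j) ⊗ₜ[k] ⟨c j, hc j⟩, by simp⟩

variable {l : ℕ} {V W : Fin l → Type*} {U : Type*}
  [∀ i, AddCommGroup (V i)] [∀ i, Module k (V i)]
  [∀ i, AddCommGroup (W i)] [∀ i, Module k (W i)]
  [AddCommGroup U] [Module k U]

/-- If `T` has the right omnipresent maximal rank property, then for every `x` the map
`b ↦ T (b • x)` is surjective or only kills the `b` that kill `x`. -/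
theorem RightOmnipresentMaxRank.surjective_or_endAct_eq_zero [∀ i, FiniteDimensional k (V i)]
    {T : (∀ i, V i ⊗[k] W i) →ₗ[k] U} (hT : RightOmnipresentMaxRank T)
    (x : ∀ i, V i ⊗[k] W i) :
    (∀ y, ∃ b, T (endAct b x) = y) ∨ ∀ b, T (endAct b x) = 0 → endAct b x = 0 := by
  choose W' hW' using fun i => exists_range_lTensor_eq_orbit (x i)
  have hmem : ∀ y, y ∈ tensorSubspace V W' ↔ ∃ b, endAct b x = y := by
    intro y
    simp only [tensorSubspace, Submodule.mem_pi, Set.mem_univ, forall_const, hW']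
    rw [Classical.skolem]
    exact exists_congr fun b => funext_iff.symm
  rcases hT W' with h | h
  · right
    intro b hb
    have h0 := @h ⟨endAct b x, (hmem _).2 ⟨b, rfl⟩⟩ 0 (by simpa using hb)
    exact congrArg Subtype.val h0
  · left
    intro y
    obtain ⟨⟨z, hz⟩, rfl⟩ := h y
    obtain ⟨b, rfl⟩ := (hmem z).1 hz
    exact ⟨b, rfl⟩

theorem eq_zero_of_endAct_eq_zero {b : ∀ i, Module.End k (V i)} (hb : ∀ i, LinearMap.det (b i) ≠ 0)
    [∀ i, FiniteDimensional k (V i)] {x : ∀ i, V i ⊗[k] W i} (hx : endAct b x = 0) : x = 0 := by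
  funext i
  have h := congrFun hx i
  have : (LinearMap.equivOfDetNeZero (b i) (hb i)).rTensor (W i) (x i) = 0 := h
  simpa using this

/-- The action of `B` followed by `T` and coordinates on `U`, as a bilinear map. -/
noncomputable def endActBilin [FiniteDimensional k U] (T : (∀ i, V i ⊗[k] W i) →ₗ[k] U) :
    (∀ i, Module.End k (V i)) →ₗ[k] (∀ i, V i ⊗[k] W i) →ₗ[k]
      (Fin (Module.finrank k U) → k) :=
  LinearMap.mk₂ k (fun b x => (Module.finBasis k U).equivFun (T (endAct b x)))
    (fun b b' x => by
      rw [← map_add, ← map_add]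
      congr 2
      funext i
      simp [endAct, LinearMap.rTensor_add])
    (fun c b x => by
      rw [← map_smul, ← map_smul]
      congr 2
      funext i
      simp [endAct, LinearMap.rTensor_smul])
    (fun b x x' => by
      rw [← map_add, ← map_add]
      congr 2
      funext i
      simp [endAct])
    (fun c b x => by
      rw [← map_smul, ← map_smul]
      congr 2
      funext i
      simp [endAct])

theorem endActBilin_apply [FiniteDimensional k U] (T : (∀ i, V i ⊗[k] W i) →ₗ[k] U)
    (b : ∀ i, Module.End k (V i)) (x : ∀ i, V i ⊗[k] W i) :
    endActBilin T b x = (Module.finBasis k U).equivFun (T (endAct b x)) := rfl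

theorem det_apply_mem_polyFun [∀ i, FiniteDimensional k (V i)] (i : Fin l) :
    (fun b : ∀ i, Module.End k (V i) => LinearMap.det (b i)) ∈
      polyFun k (∀ i, Module.End k (V i)) := by
  classical
  let v := Module.finBasis k (V i)
  simp only [← LinearMap.det_toMatrix v]
  refine det_mem_polyFun fun a c => ?_
  simp only [LinearMap.toMatrix_apply]
  exact dual_mem_polyFun (v.coord a ∘ₗ LinearMap.applyₗ (v c) ∘ₗ
    LinearMap.proj (φ := fun i => Module.End k (V i)) i)

end Main

theorem theorem2p1 {k : Type*} [Field k] [IsAlgClosed k] {l : ℕ}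
    {V W : Fin l → Type*} {U : Type*}
    [∀ i, AddCommGroup (V i)] [∀ i, Module k (V i)] [∀ i, FiniteDimensional k (V i)]
    [∀ i, AddCommGroup (W i)] [∀ i, Module k (W i)] [∀ i, FiniteDimensional k (W i)]
    [AddCommGroup U] [Module k U] [FiniteDimensional k U]
    (T : (∀ i, V i ⊗[k] W i) →ₗ[k] U)
    (X : ∀ i, Set (ℙ k (V i ⊗[k] W i)))
    (hX : ∀ i, IsIrreducibleQuasiprojective (X i))
    (hT : RightOmnipresentMaxRank T)
    (hdim : ∑ i, zariskiDim k (affineCone (X i)) ≤ (Module.finrank k U : WithBot ℕ∞)) :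
    ∃ Z : Set (∀ i, Module.End k (V i)),
      IsClosed[zariskiTopology k (∀ i, Module.End k (V i))] Z ∧ Z ≠ Set.univ ∧
        Prod.fst '' (Prod.snd ⁻¹' joinSet X ∩ kernelIncidence T) ⊆ Z := by
  have : Infinite k := IsAlgClosed.instInfinite
  choose n hn hn' using fun i => (hX i).exists_irredDimLE
  have hsum : ∑ i, n i ≤ Module.finrank k U := by
    have := (Finset.sum_le_sum fun i _ => hn' i).trans hdim
    exact_mod_cast this
  have hD := (IrredDimLE.pi hn).mono hsum
  obtain ⟨F, hF, hF0, hFv⟩ := exists_polyFun_vanishing_of_surjective (endActBilin T) hD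
    fun c x hx i _ => smul_mem_affineCone c (hx i trivial)
  have hdet : (fun b : ∀ i, Module.End k (V i) => ∏ i, LinearMap.det (b i)) ∈
      polyFun k (∀ i, Module.End k (V i)) :=
    prod_mem_polyFun _ fun i _ => det_apply_mem_polyFun i
  -- The determinants handle the injective case and `F` the surjective one. Since `B` is irreducible
  -- and neither factor is identically zero, the zero locus of the product is proper.
  refine ⟨{b | ∀ G ∈ ({(fun b => ∏ i, LinearMap.det (b i)) * F} :
    Set ((∀ i, Module.End k (V i)) → k)), G b = 0}, isClosed_zariski_iff.2 ⟨_, ?_, rfl⟩, ?_, ?_⟩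
  · rintro _ rfl
    exact (polyFun k _).mul_mem hdet hF
  · intro huniv
    rcases (IsPolyIrred.univ (k := k) (M := ∀ i, Module.End k (V i))).2 _ hdet _ hF
      fun b _ => (Set.ext_iff.1 huniv b).2 trivial _ rfl with h | h
    · simpa using h 1 trivial
    · obtain ⟨b, hb⟩ := hF0
      exact hb (h b trivial)
  · rintro _ ⟨⟨b, p⟩, ⟨hp, hbp⟩, rfl⟩ _ rfl
    have hrep : p.rep ∈ p.submodule := by
      rw [Projectivization.submodule_eq]
      exact Submodule.mem_span_singleton_self _
    have hker : T (endAct b p.rep) = 0 := hbp p.rep hrep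
    rw [Pi.mul_apply, mul_eq_zero]
    rcases hT.surjective_or_endAct_eq_zero p.rep with h | h
    · refine Or.inr (hFv b p.rep (fun i _ => hp p.rep hrep i) p.rep_nonzero ?_ fun y => ?_)
      · rw [endActBilin_apply, hker, map_zero]
      · obtain ⟨b', hb'⟩ := h ((Module.finBasis k U).equivFun.symm y)
        refine ⟨b', ?_⟩
        rw [LinearMap.flip_apply, endActBilin_apply, hb', LinearEquiv.apply_symm_apply]
    · left
      by_contra hne
      exact p.rep_nonzero (eq_zero_of_endAct_eq_zero
        (fun i => Finset.prod_ne_zero_iff.1 hne i (Finset.mem_univ i)) (h b hker))
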